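/- Consider three online problems on a metric space $(M,d)$, from a given initial configuration. In the $k$-server problem, $k$ servers move in $M$ and each request is a point of $M$ that must be visited by one of the servers; the cost is the total distance travelled. In the $k$-taxi problem, each request is a pair $(a,b)\in M^2$; some taxi must drive to $a$ and is then carried to $b$ for free; the cost is the total distance of all other movement. In chasing small sets, a single server moves in $M$ and each request is a set of at most $k$ points of $M$, given as a tuple $(x_1,\dots,x_k)\in M^k$, one of which the server must visit; the cost is the total distance travelled. A randomized online algorithm chooses its configuration after $t$ requests as a function of a random seed and of the first $t$ requests only. Let $M$ be a closed ball in $\ell_\infty^m=(\mathbb R^m,\|\cdot\|_\infty)$. For $\sigma\in(0,1]$, a distribution $D$ of a request is $\sigma$-smooth if, under the marginal distribution of each of its points, every measurable $S\subseteq M$ has probability at most $1/\sigma$ times its probability under the uniform distribution on $M$. An algorithm is $\rho$-competitive on i.i.d. requests from $D$ if there is a constant $\alpha$ such that for every $T$, when $r_1,\dots,r_T$ are drawn independently from $D$, its expected cost is at most $\rho\cdot\mathbb E[\mathrm{OPT}(r_1,\dots,r_T)]+\alpha$, where $\mathrm{OPT}$ is the optimal offline cost of the realized sequence from the same initial configuration.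 Theorem. For any $c<1/2$, there is no $O(\log^c(k/\sigma))$-competitive randomized online algorithm on $\sigma$-smooth instances of $k$-server, $k$-taxi, or chasing small sets, even when the metric space is a ball in $O(\log k)$-dimensional $\ell_\infty$-space and the requests are independent and identically distributed. Precisely: there is an absolute constant $K$ such that for every $c<1/2$ and every constant $C$, for all sufficiently large $k$ there are a dimension $m\le K\log k$ and $\sigma\in(0,1]$ such that, for every closed ball $M$ of positive radius in $\ell_\infty^m$ and for each of the three problems on $M$, there is a $\sigma$-smooth distribution $D$ of a request for which no randomized online algorithm, from any initial configuration (even one that knows $k$, $\sigma$, $M$ and $D$), is $C\log^c(k/\sigma)$-competitive on i.i.d. requests from $D$. -/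

import Mathlib

open MeasureTheory
open scoped ENNReal NNReal

universe u

namespace OnlineLB

section Problems

variable {M : Type*} [PseudoEMetricSpace M] {k : ℕ}

/-- The `k`-taxi problem: least cost, given taxis at `s`, of serving the ride `(r.1, r.2)` and ending
in the configuration `s'`. Some taxi `i` drives empty from `s i` to `r.1`, carries the ride to `r.2`
for free and may then drive on, empty, to `s' i`; every other taxi `j` drives empty to `s' j`. -/
noncomputable def taxiStep (s : Fin k → M) (r : M × M) (s' : Fin k → M) : ℝ≥0∞ :=
  ⨅ i : Fin k, (edist (s i) r.1 + edist r.2 (s' i)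
    + ∑ j ∈ Finset.univ.erase i, edist (s j) (s' j))

/-- The `k`-server problem: least total distance, given servers at `s`, of serving the request `r`
and ending in the configuration `s'`. Some server `i` visits `r` on its way from `s i` to `s' i`. -/
noncomputable def serverStep (s : Fin k → M) (r : M) (s' : Fin k → M) : ℝ≥0∞ :=
  ⨅ i : Fin k, (edist (s i) r + edist r (s' i)
    + ∑ j ∈ Finset.univ.erase i, edist (s j) (s' j))

/-- Chasing sets of size at most `k`: a single server at `s` must visit one of the points of the
requested set `{r 0, …, r (k - 1)}` on its way to `s'`. -/
noncomputable def chasingStep (s : M) (r : Fin k → M) (s' : M) : ℝ≥0∞ :=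
  ⨅ i : Fin k, (edist s (r i) + edist (r i) s')

end Problems

section Costs

variable {C R : Type*}

/-- Cost of serving the requests `r 0, …, r (T - 1)` along the configurations `x 0, …, x T`, where
`step s a s'` is the cost of serving the request `a` while passing from `s` to `s'`. -/
noncomputable def pathCost (step : C → R → C → ℝ≥0∞) {T : ℕ} (r : Fin T → R)
    (x : Fin (T + 1) → C) : ℝ≥0∞ :=
  ∑ t : Fin T, step (x t.castSucc) (r t) (x t.succ)

/-- Optimal offline cost from the initial configuration `s₀`. -/
noncomputable def optCost (step : C → R → C → ℝ≥0∞) (s₀ : C) {T : ℕ} (r : Fin T → R) : ℝ≥0∞ :=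
  ⨅ x : {x : Fin (T + 1) → C // x 0 = s₀}, pathCost step r x.1

variable (C R) in
/-- A randomized online algorithm with configurations in `C` and requests in `R`: after drawing a
random seed `ω`, its configuration after `t` requests is a function of these `t` requests. -/
structure RandomizedAlgorithm [MeasurableSpace C] [MeasurableSpace R] where
  /-- random seeds -/
  Ω : Type u
  /-- events of seeds -/
  mΩ : MeasurableSpace Ω
  /-- law of the seed -/
  P : Measure Ω
  isProb : IsProbabilityMeasure P
  /-- configuration after the first `t` requests -/
  config : (t : ℕ) → Ω → (Fin t → R) → C
  measurable_config : ∀ t, Measurable fun p : Ω × (Fin t → R) => config t p.1 p.2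

variable [MeasurableSpace C] [MeasurableSpace R]

/-- The algorithm starts in the configuration `s₀`. -/
def RandomizedAlgorithm.StartsAt (A : RandomizedAlgorithm.{u} C R) (s₀ : C) : Prop :=
  ∀ ω r, A.config 0 ω r = s₀

/-- The configurations of the algorithm with seed `ω` on the request sequence `r`. -/
def RandomizedAlgorithm.trajectory (A : RandomizedAlgorithm.{u} C R) (ω : A.Ω) {T : ℕ}
    (r : Fin T → R) : Fin (T + 1) → C :=
  fun t => A.config t ω (Fin.take t t.is_le r)

/-- Expected cost, over the random seed, of the algorithm on the request sequence `r`. -/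
noncomputable def RandomizedAlgorithm.cost (A : RandomizedAlgorithm.{u} C R)
    (step : C → R → C → ℝ≥0∞) {T : ℕ} (r : Fin T → R) : ℝ≥0∞ :=
  @lintegral A.Ω A.mΩ A.P fun ω => pathCost step r (A.trajectory ω r)

/-- The algorithm, started in `s₀`, is `ρ`-competitive in expectation on sequences (of every length
`T`) of independent requests with common distribution `D`. -/
def IsCompetitiveIID (step : C → R → C → ℝ≥0∞) (s₀ : C) (D : Measure R)
    (A : RandomizedAlgorithm.{u} C R) (ρ : ℝ) : Prop :=
  ∃ α : ℝ≥0, ∀ T : ℕ,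
    ∫⁻ r, A.cost step r ∂(Measure.pi fun _ : Fin T => D) ≤
      ENNReal.ofReal ρ * (∫⁻ r, optCost step s₀ r ∂(Measure.pi fun _ : Fin T => D)) + α

/-- No randomized online algorithm, from any initial configuration, is `ρ`-competitive in
expectation on independent requests with common distribution `D`. The algorithm may depend on
everything here, including `D`. -/
def NoCompetitiveIID (step : C → R → C → ℝ≥0∞) (D : Measure R) (ρ : ℝ) : Prop :=
  ∀ (s₀ : C) (A : RandomizedAlgorithm.{u} C R), A.StartsAt s₀ → ¬ IsCompetitiveIID step s₀ D A ρ

end Costs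

section Smooth

/-- The closed ball with centre `z` and radius `ϱ` in `m`-dimensional `ℓ∞` space, as a metric space
(the norm of `Fin m → ℝ` is the maximum norm). -/
abbrev Ball {m : ℕ} (z : Fin m → ℝ) (ϱ : ℝ) : Type := ↥(Metric.closedBall z ϱ)

/-- The uniform distribution over the ball. -/
noncomputable def uniformBall {m : ℕ} (z : Fin m → ℝ) (ϱ : ℝ) : Measure (Ball z ϱ) :=
  (ProbabilityTheory.cond volume (Metric.closedBall z ϱ)).comap Subtype.val

/-- A distribution of a point is `σ`-smooth if it gives every measurable set at most `1 / σ` times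
its probability under the uniform distribution over the ball. -/
def IsSmooth (σ : ℝ) {m : ℕ} {z : Fin m → ℝ} {ϱ : ℝ} (μ : Measure (Ball z ϱ)) : Prop :=
  ∀ S : Set (Ball z ϱ), MeasurableSet S → μ S ≤ ENNReal.ofReal (1 / σ) * uniformBall z ϱ S

end Smooth

end OnlineLB

/-! Take `k + 1` points of the ball at pairwise distance comparable to its radius `ϱ`, and let each
request carry an independent uniform label among them. For servers and taxis the request lies close
to the labelled point; for chasing it lists points close to all the others.

Online, every configuration is badly placed for some label: `k` servers cannot be near `k + 1`
separated points, and a single point is near at most one of them. The next label is independent of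
the past, so each request costs at least `lam / (k + 1)` in expectation (`mul_le_lintegral_cost`).

Offline, a phase lasts until all labels have been seen. The player knows which label comes last and
stays good for it, so one large move `Δ` per phase suffices, besides at most `δ` per request. A
phase is a coupon collection and takes `(k + 1) * harmonic k` draws on average
(`lintegral_guessCost_le`). Since `Δ` and `lam` are both of order `ϱ`, the ratio is of order `log k`
once `δ` is small.

Smoothing: blur each point uniformly over a ball of radius `ε * ϱ`. This is `ε ^ m`-smooth and gives
`δ = 2 * ε * ϱ`. In ℓ∞ the corners of a cube provide the points with `m = O(log k)`. For `ε = 1 / (k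
+ 1) ^ 2`, `log (k / σ)` is `O(log² k)`, so a bound of order `log k` excludes every exponent below
`1 / 2`. -/

namespace OnlineLB

/-! ### Recursive bounds on the offline optimum -/

section OfflineCost

variable {C R : Type*} {step : C → R → C → ℝ≥0∞}

lemma optCost_cons_le (s s' : C) (x : R) {T : ℕ} (r : Fin T → R) :
    optCost step s (Fin.cons x r : Fin (T + 1) → R) ≤ step s x s' + optCost step s' r := by
  unfold optCost
  rw [ENNReal.add_iInf]
  refine le_iInf fun y => ?_
  refine (iInf_le _ ⟨Fin.cons s y.1, by simp⟩).trans ?_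
  simp only [pathCost, Fin.sum_univ_succ, Fin.castSucc_zero, Fin.cons_zero, Fin.cons_succ, y.2,
    ← Fin.succ_castSucc]
  exact le_rfl

lemma optCost_le_add {B : ℝ≥0∞} {s₀ s : C} (h : ∀ x s', step s₀ x s' ≤ B + step s x s')
    {T : ℕ} (r : Fin T → R) : optCost step s₀ r ≤ B + optCost step s r := by
  cases T with
  | zero =>
    refine (iInf_le _ ⟨fun _ => s₀, rfl⟩).trans ?_
    simp [pathCost]
  | succ T =>
    unfold optCost
    rw [ENNReal.add_iInf]
    refine le_iInf fun y => ?_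
    refine (iInf_le _ ⟨Fin.cons s₀ (Fin.tail y.1), by simp⟩).trans ?_
    simp only [pathCost, Fin.sum_univ_succ, Fin.castSucc_zero, Fin.cons_zero, Fin.cons_succ, y.2,
      ← Fin.succ_castSucc, Fin.tail, ← add_assoc]
    gcongr
    exact h _ _

end OfflineCost

/-! ### Online cost per request -/

section OnlineCost

lemma take_insertNth {R : Type*} {T : ℕ} (t : Fin (T + 1)) (x : R) (r : Fin T → R) :
    Fin.take t t.is_lt.le (Fin.insertNth t x r : Fin (T + 1) → R) =
      fun i : Fin t => r ⟨i, by omega⟩ := by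
  funext i
  have h : Fin.castLE t.is_lt.le i = t.succAbove ⟨i, by omega⟩ := by
    rw [Fin.succAbove_of_castSucc_lt]
    · rfl
    · exact Fin.lt_def.2 i.2
  rw [Fin.take_apply, h, Fin.insertNth_apply_succAbove]

variable {C R : Type*} [MeasurableSpace C] [MeasurableSpace R] {step : C → R → C → ℝ≥0∞}

lemma measurable_take {T : ℕ} (t : ℕ) (h : t ≤ T) :
    Measurable fun r : Fin T → R => (Fin.take t h r : Fin t → R) :=
  measurable_pi_lambda _ fun _ => measurable_pi_apply _

/-- The configuration before a request is independent of that request. The one after it may depend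
on it, which is why `s'` in `hκ` is an arbitrary function of `x`. -/
lemma mul_le_lintegral_cost (hstep : Measurable fun p : C × R × C => step p.1 p.2.1 p.2.2)
    (D : Measure R) [IsProbabilityMeasure D] {κ : ℝ≥0∞}
    (hκ : ∀ (s : C) (s' : R → C), κ ≤ ∫⁻ x, step s x (s' x) ∂D)
    (A : RandomizedAlgorithm.{u} C R) (T : ℕ) :
    T * κ ≤ ∫⁻ r, A.cost step r ∂(Measure.pi fun _ : Fin T => D) := by
  let _ := A.mΩ
  have := A.isProb
  have hconf (t : ℕ) (h : t ≤ T) :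
      Measurable fun p : (Fin T → R) × A.Ω => A.config t p.2 (Fin.take t h p.1) :=
    (A.measurable_config t).comp
      (measurable_snd.prodMk ((measurable_take t h).comp measurable_fst))
  have hmeas (t : Fin T) : Measurable fun p : (Fin T → R) × A.Ω =>
      step (A.trajectory p.2 p.1 t.castSucc) (p.1 t) (A.trajectory p.2 p.1 t.succ) :=
    hstep.comp ((hconf t t.is_lt.le).prodMk
      (((measurable_pi_apply t).comp measurable_fst).prodMk (hconf (t + 1) t.is_lt)))
  have hterm (t : Fin T) : κ ≤ ∫⁻ r, ∫⁻ ω,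
      step (A.trajectory ω r t.castSucc) (r t) (A.trajectory ω r t.succ) ∂A.P
        ∂(Measure.pi fun _ : Fin T => D) := by
    rw [lintegral_lintegral_swap (hmeas t).aemeasurable]
    have key (ω : A.Ω) : κ ≤ ∫⁻ r,
        step (A.trajectory ω r t.castSucc) (r t) (A.trajectory ω r t.succ)
          ∂(Measure.pi fun _ : Fin T => D) := by
      have hm : Measurable fun r : Fin T → R =>
          step (A.trajectory ω r t.castSucc) (r t) (A.trajectory ω r t.succ) :=
        (hmeas t).comp (measurable_id.prodMk measurable_const)
      obtain _ | T := T
      · exact t.elim0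
      -- With the seed and all other requests fixed, only request `t` is integrated, and the
      -- configuration before it is constant.
      rw [← ((measurePreserving_piFinSuccAbove (fun _ : Fin (T + 1) => D) t).symm).lintegral_comp
        hm]
      refine le_of_le_of_eq ?_ (lintegral_prod_symm _
        (hm.comp (MeasurableEquiv.measurable _)).aemeasurable).symm
      calc κ = ∫⁻ _, κ ∂(Measure.pi fun _ : Fin T => D) := by simp
        _ ≤ _ := by
          refine lintegral_mono fun r => ?_
          refine (hκ (A.config t ω fun i : Fin t => r ⟨i, by omega⟩) fun x =>
            A.trajectory ω (Fin.insertNth t x r : Fin (T + 1) → R) t.succ).trans_eq ?_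
          refine lintegral_congr fun x => ?_
          have h1 : A.trajectory ω (Fin.insertNth t x r : Fin (T + 1) → R) t.castSucc =
              A.config t ω fun i : Fin t => r ⟨i, by omega⟩ :=
            congrArg (A.config t ω) (take_insertNth t x r)
          have h2 : (Fin.insertNth t x r : Fin (T + 1) → R) t = x :=
            Fin.insertNth_apply_same (α := fun _ => R) t x r
          change _ = step (A.trajectory ω (Fin.insertNth t x r : Fin (T + 1) → R) t.castSucc)
            ((Fin.insertNth t x r : Fin (T + 1) → R) t)
            (A.trajectory ω (Fin.insertNth t x r : Fin (T + 1) → R) t.succ)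
          rw [h1, h2]
    calc κ = ∫⁻ _, κ ∂A.P := by simp
      _ ≤ _ := lintegral_mono key
  calc (T : ℝ≥0∞) * κ = ∑ _t : Fin T, κ := by simp
    _ ≤ ∑ t : Fin T, ∫⁻ r, ∫⁻ ω,
        step (A.trajectory ω r t.castSucc) (r t) (A.trajectory ω r t.succ) ∂A.P
          ∂(Measure.pi fun _ : Fin T => D) := Finset.sum_le_sum fun t _ => hterm t
    _ = _ := by
      rw [← lintegral_finsetSum _ fun t _ => (hmeas t).lintegral_prod_right']
      refine lintegral_congr fun r => ?_
      rw [RandomizedAlgorithm.cost]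
      simp only [pathCost]
      exact (lintegral_finsetSum _ fun t _ =>
        (hmeas t).comp (measurable_const.prodMk measurable_id)).symm

end OnlineCost

/-! ### Abstract lower bound by coupon collecting -/

section Coupons

variable {C R : Type*} {k : ℕ}

/-- The expected number of uniform draws from `k + 1` coupons that take a collector from one kind
of coupon to `j` kinds. -/
noncomputable def drawsUntil (k j : ℕ) : ℝ := (k + 1) * (harmonic k - harmonic (k + 1 - j))

lemma drawsUntil_one : drawsUntil k 1 = 0 := by simp [drawsUntil]

lemma drawsUntil_full : drawsUntil k (k + 1) = (k + 1) * harmonic k := by simp [drawsUntil]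

lemma drawsUntil_nonneg {j : ℕ} (hj : 0 < j) : 0 ≤ drawsUntil k j := by
  have h : harmonic (k + 1 - j) ≤ harmonic k :=
    Finset.sum_le_sum_of_subset_of_nonneg (Finset.range_mono (by omega)) fun i _ _ => by positivity
  have h' : (harmonic (k + 1 - j) : ℝ) ≤ harmonic k := by exact_mod_cast h
  exact mul_nonneg (by positivity) (sub_nonneg.2 h')

lemma drawsUntil_full_pos (hk : 0 < k) : 0 < drawsUntil k (k + 1) := by
  rw [drawsUntil_full]
  have : (0 : ℝ) < harmonic k := by exact_mod_cast harmonic_pos hk.ne'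
  positivity

/-- One draw from `j` kinds finds a new one with probability `(k + 1 - j) / (k + 1)`, so
`drawsUntil` grows by exactly one per draw in expectation. This makes it a potential function. -/
lemma drawsUntil_succ {j : ℕ} (hj : j ≤ k) :
    (k + 1 - j) * drawsUntil k (j + 1) = (k + 1 - j) * drawsUntil k j + (k + 1) := by
  have h : k + 1 - j = (k - j) + 1 := by omega
  have h0 : ((k : ℝ) - j + 1) ≠ 0 := by
    have : (j : ℝ) ≤ k := by exact_mod_cast hj
    linarith
  rw [drawsUntil, drawsUntil, h, Nat.add_sub_add_right, harmonic_succ]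
  push_cast [Nat.cast_sub hj]
  field_simp
  ring

/-- Least cost of serving `r` from the worst start among the configurations that are good for
a label `b`, for the best `b` outside `S`. -/
noncomputable def guessCost (step : C → R → C → ℝ≥0∞) (Good : Fin (k + 1) → C → Prop)
    (S : Finset (Fin (k + 1))) {T : ℕ} (r : Fin T → R) : ℝ≥0∞ :=
  ⨅ b : {b // b ∉ S}, ⨆ s : {s // Good b s}, optCost step s.1 r

/-- Labels `a` of requests, drawn uniformly, behave like coupons: a configuration that is good for
`b` serves all requests with label `a ≠ b` at cost at most `δ`, and at cost at most `Δ` it can be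
replaced, when a request with label `b` comes, by one that is good for another label. -/
structure IsCouponSystem (step : C → R → C → ℝ≥0∞) (Good : Fin (k + 1) → C → Prop)
    (E : Fin (k + 1) → Set R) (δ Δ B lam : ℝ) : Prop where
  exists_good : ∀ b, ∃ s, Good b s
  stay : ∀ a b s, a ≠ b → Good b s → ∀ x ∈ E a, step s x s ≤ ENNReal.ofReal δ
  move : ∀ a b s, a ≠ b → Good a s → ∀ x ∈ E a,
    ∃ s', Good b s' ∧ step s x s' ≤ ENNReal.ofReal Δ
  start : ∀ s₀ s x s', step s₀ x s' ≤ ENNReal.ofReal B + step s x s'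
  miss : ∀ s, ∃ a, ∀ x ∈ E a, ∀ s', ENNReal.ofReal lam ≤ step s x s'

/-- The uniform mixture of measures. -/
noncomputable def mixture [MeasurableSpace R] (D : Fin (k + 1) → Measure R) : Measure R :=
  ((k + 1 : ℕ) : ℝ≥0∞)⁻¹ • ∑ a, D a

lemma lintegral_mixture [MeasurableSpace R] (D : Fin (k + 1) → Measure R) (f : R → ℝ≥0∞) :
    ∫⁻ x, f x ∂(mixture D) = ((k + 1 : ℕ) : ℝ≥0∞)⁻¹ * ∑ a, ∫⁻ x, f x ∂(D a) := by
  rw [mixture, lintegral_smul_measure, lintegral_finsetSum_measure, smul_eq_mul]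

lemma mixture_apply [MeasurableSpace R] (D : Fin (k + 1) → Measure R) (S : Set R) :
    mixture D S = ((k + 1 : ℕ) : ℝ≥0∞)⁻¹ * ∑ a, D a S := by
  simp [mixture]

lemma inv_mul_sum_le {f : Fin (k + 1) → ℝ≥0∞} {c : ℝ≥0∞} (h : ∀ a, f a ≤ c) :
    ((k + 1 : ℕ) : ℝ≥0∞)⁻¹ * ∑ a, f a ≤ c := by
  calc _ ≤ ((k + 1 : ℕ) : ℝ≥0∞)⁻¹ * ∑ _a : Fin (k + 1), c := by gcongr; exact h _
    _ = c := by
      rw [Finset.sum_const, Finset.card_univ, Fintype.card_fin, nsmul_eq_mul, ← mul_assoc,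
        ENNReal.inv_mul_cancel (by simp) (by simp), one_mul]

instance isProbabilityMeasure_mixture [MeasurableSpace R] (D : Fin (k + 1) → Measure R)
    [∀ a, IsProbabilityMeasure (D a)] : IsProbabilityMeasure (mixture D) := by
  constructor
  rw [mixture_apply]
  simp only [measure_univ, Finset.sum_const, Finset.card_univ, Fintype.card_fin, nsmul_eq_mul,
    mul_one]
  exact ENNReal.inv_mul_cancel (by simp) (by simp)

namespace IsCouponSystem

variable {step : C → R → C → ℝ≥0∞} {Good : Fin (k + 1) → C → Prop}
  {E : Fin (k + 1) → Set R} {δ Δ B lam : ℝ}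

lemma guessCost_cons_le (h : IsCouponSystem step Good E δ Δ B lam)
    (S : Finset (Fin (k + 1))) {a : Fin (k + 1)} {x : R} (hx : x ∈ E a) {T : ℕ} (r : Fin T → R) :
    guessCost step Good S (Fin.cons x r : Fin (T + 1) → R) ≤
      ENNReal.ofReal δ + guessCost step Good (insert a S) r := by
  unfold guessCost
  rw [ENNReal.add_iInf]
  refine le_iInf fun ⟨b, hb⟩ => ?_
  rw [Finset.mem_insert, not_or] at hb
  refine (iInf_le _ ⟨b, hb.2⟩).trans (iSup_le fun s => ?_)
  refine (optCost_cons_le s.1 s.1 x r).trans (add_le_add ?_ ?_)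
  · exact h.stay a b s.1 (Ne.symm hb.1) s.2 x hx
  · exact le_iSup (fun s : {s // Good b s} => optCost step s.1 r) s

/-- Used when `a` is the last missing label: the guess was `a`, and a new phase starts in which only
`a` has been seen. -/
lemma guessCost_cons_le_of_notMem (h : IsCouponSystem step Good E δ Δ B lam)
    {S : Finset (Fin (k + 1))} {a : Fin (k + 1)} (ha : a ∉ S) {x : R} (hx : x ∈ E a)
    {T : ℕ} (r : Fin T → R) :
    guessCost step Good S (Fin.cons x r : Fin (T + 1) → R) ≤
      ENNReal.ofReal Δ + guessCost step Good {a} r := by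
  unfold guessCost
  rw [ENNReal.add_iInf]
  refine le_iInf fun ⟨b, hb⟩ => ?_
  rw [Finset.mem_singleton] at hb
  refine (iInf_le _ ⟨a, ha⟩).trans (iSup_le fun s => ?_)
  obtain ⟨s', hs', hc⟩ := h.move a b s.1 (Ne.symm hb) s.2 x hx
  refine (optCost_cons_le s.1 s' x r).trans (add_le_add hc ?_)
  exact le_iSup (fun s : {s // Good b s} => optCost step s.1 r) ⟨s', hs'⟩

lemma optCost_le (h : IsCouponSystem step Good E δ Δ B lam) (s₀ : C)
    {S : Finset (Fin (k + 1))} {T : ℕ} (r : Fin T → R) :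
    optCost step s₀ r ≤ ENNReal.ofReal B + guessCost step Good S r := by
  unfold guessCost
  rw [ENNReal.add_iInf]
  refine le_iInf fun b => ?_
  obtain ⟨s, hs⟩ := h.exists_good b
  refine (optCost_le_add (h.start s₀ s) r).trans (add_le_add le_rfl ?_)
  exact le_iSup (fun s : {s // Good b.1 s} => optCost step s.1 r) ⟨s, hs⟩

variable [MeasurableSpace R] {D : Fin (k + 1) → Measure R} [∀ a, IsProbabilityMeasure (D a)]

/-- An inequality is enough for bounding the optimum from above, and it needs no measurability of
the infimum over configurations. -/
lemma lintegral_cons_le (μ : Measure R) [SigmaFinite μ] {T : ℕ} (f : (Fin (T + 1) → R) → ℝ≥0∞) :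
    ∫⁻ r, f r ∂(Measure.pi fun _ : Fin (T + 1) => μ) ≤
      ∫⁻ x, ∫⁻ r, f (Fin.cons x r) ∂(Measure.pi fun _ : Fin T => μ) ∂μ := by
  rw [← ((measurePreserving_piFinSuccAbove (fun _ : Fin (T + 1) => μ) 0).symm).map_eq,
    lintegral_map_equiv]
  refine (lintegral_prod_le _).trans_eq ?_
  refine lintegral_congr fun x => lintegral_congr fun r => ?_
  exact congrArg f (Fin.insertNth_zero' (β := R) x r)

/-- Here `S` is the set of labels seen in the current phase. `T + drawsUntil k S.card` counts draws,
including those already credited to this phase, and each full collection is charged `Δ`. The guess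
is an infimum inside the integral, hence made in hindsight. -/
lemma lintegral_guessCost_le (h : IsCouponSystem step Good E δ Δ B lam) (hδ : 0 ≤ δ) (hΔ : 0 ≤ Δ)
    (hk : 0 < k) (hD : ∀ a, ∀ᵐ x ∂(D a), x ∈ E a) (T : ℕ) {S : Finset (Fin (k + 1))}
    (hS : S.Nonempty) (hS' : S ≠ Finset.univ) :
    ∫⁻ r, guessCost step Good S r ∂(Measure.pi fun _ : Fin T => mixture D) ≤
      ENNReal.ofReal (Δ / drawsUntil k (k + 1) * (T + drawsUntil k S.card) + T * δ) := by
  induction T generalizing S with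
  | zero =>
    obtain ⟨b, hb⟩ : ∃ b, b ∉ S := by
      by_contra! hall
      exact hS' (Finset.eq_univ_iff_forall.2 hall)
    have h0 (r : Fin 0 → R) : guessCost step Good S r ≤ 0 := by
      refine (iInf_le _ ⟨b, hb⟩).trans (iSup_le fun s => ?_)
      refine (iInf_le _ ⟨fun _ => s.1, rfl⟩).trans ?_
      simp [pathCost]
    exact (lintegral_mono h0).trans (by simp)
  | succ T ih =>
    have hA := drawsUntil_full_pos hk
    set A := drawsUntil k (k + 1) with hAdef
    set v : ℕ → ℝ := fun j => Δ / A * (T + drawsUntil k j) + T * δ with hv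
    have hv0 (j : ℕ) (hj : 0 < j) : 0 ≤ v j := by
      have := drawsUntil_nonneg (k := k) hj
      simp only [hv]
      positivity
    set V : Fin (k + 1) → ℝ := fun a => δ + v (insert a S).card with hV
    have hV0 (a : Fin (k + 1)) : 0 ≤ V a :=
      add_nonneg hδ (hv0 _ (Finset.card_pos.2 (Finset.insert_nonempty a S)))
    have hone (a : Fin (k + 1)) (x : R) (hx : x ∈ E a) :
        ∫⁻ r, guessCost step Good S (Fin.cons x r : Fin (T + 1) → R)
          ∂(Measure.pi fun _ : Fin T => mixture D) ≤ ENNReal.ofReal (V a) := by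
      -- If `a` completes the phase, the potential drops from `drawsUntil k (k + 1)` to `drawsUntil
      -- k 1 = 0`, which pays for exactly one `Δ`.
      by_cases hins : insert a S = Finset.univ
      · have ha : a ∉ S := fun ha => hS' (by rwa [Finset.insert_eq_of_mem ha] at hins)
        have hcard : (insert a S).card = k + 1 := by rw [hins]; simp
        refine (lintegral_mono fun r => h.guessCost_cons_le_of_notMem ha hx r).trans ?_
        rw [lintegral_add_left measurable_const, lintegral_const, measure_univ, mul_one]
        have hne : ({a} : Finset (Fin (k + 1))) ≠ Finset.univ := by
          intro he
          have := congrArg Finset.card he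
          simp at this
          omega
        refine (add_le_add le_rfl (ih (Finset.singleton_nonempty a) hne)).trans ?_
        rw [Finset.card_singleton, ← ENNReal.ofReal_add hΔ (hv0 1 one_pos)]
        apply ENNReal.ofReal_le_ofReal
        simp only [hV, hv, hcard, drawsUntil_one, ← hAdef]
        have : Δ / A * A = Δ := by field_simp
        nlinarith
      · refine (lintegral_mono fun r => h.guessCost_cons_le S hx r).trans ?_
        rw [lintegral_add_left measurable_const, lintegral_const, measure_univ, mul_one]
        refine (add_le_add le_rfl (ih (Finset.insert_nonempty a S) hins)).trans_eq ?_
        rw [← ENNReal.ofReal_add hδ (hv0 _ (Finset.card_pos.2 (Finset.insert_nonempty a S)))]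
    refine (lintegral_cons_le _ _).trans ?_
    rw [lintegral_mixture]
    have hsum : ∑ a, V a =
        (k + 1) * (Δ / A * ((T + 1 : ℕ) + drawsUntil k S.card) + (T + 1 : ℕ) * δ) := by
      have hj : S.card ≤ k := by
        have := Finset.card_lt_card (Finset.ssubset_univ_iff.2 hS')
        simp at this
        omega
      have h1 : ∑ a ∈ S, V a = S.card * (δ + v S.card) := by
        rw [← nsmul_eq_mul, ← Finset.sum_const]
        exact Finset.sum_congr rfl fun a ha => by simp only [hV, Finset.insert_eq_of_mem ha]
      have h2 : ∑ a ∈ Sᶜ, V a = (k + 1 - S.card) * (δ + v (S.card + 1)) := by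
        have hc : (Sᶜ.card : ℝ) = k + 1 - S.card := by
          rw [Finset.card_compl, Fintype.card_fin, Nat.cast_sub (by omega)]
          push_cast
          rfl
        rw [← hc, ← nsmul_eq_mul, ← Finset.sum_const]
        exact Finset.sum_congr rfl fun a ha => by
          simp only [hV, Finset.card_insert_of_notMem (Finset.mem_compl.1 ha)]
      rw [← Finset.sum_add_sum_compl S, h1, h2]
      have h3 := drawsUntil_succ hj
      simp only [hv]
      push_cast
      linear_combination (Δ / A) * h3
    calc _ ≤ ((k + 1 : ℕ) : ℝ≥0∞)⁻¹ * ∑ a, ENNReal.ofReal (V a) := by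
          gcongr with a
          refine (lintegral_mono_ae ((hD a).mono fun x hx => hone a x hx)).trans_eq ?_
          rw [lintegral_const, measure_univ, mul_one]
      _ = _ := by
          rw [← ENNReal.ofReal_sum_of_nonneg fun a _ => hV0 a, hsum,
            ENNReal.ofReal_mul (by positivity), ← mul_assoc]
          rw [show ((k : ℝ) + 1) = ((k + 1 : ℕ) : ℝ) by push_cast; rfl, ENNReal.ofReal_natCast,
            ENNReal.inv_mul_cancel (by simp) (by simp), one_mul]

/-- Per request, the online cost is at least `lam / (k + 1)` and the optimum at most `Δ / drawsUntil
k (k + 1) + δ`; for large `T` the constants `B` and `α` do not matter. -/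
theorem noCompetitiveIID [MeasurableSpace C] (h : IsCouponSystem step Good E δ Δ B lam)
    (hstep : Measurable fun p : C × R × C => step p.1 p.2.1 p.2.2)
    (hδ : 0 ≤ δ) (hΔ : 0 ≤ Δ) (hB : 0 ≤ B) (hk : 0 < k) (hD : ∀ a, ∀ᵐ x ∂(D a), x ∈ E a)
    {ρ : ℝ} (hρ : (k + 1) * ρ * (Δ / drawsUntil k (k + 1) + δ) < lam) (hlam : 0 < lam) :
    NoCompetitiveIID.{u} step (mixture D) ρ := by
  rintro s₀ A - ⟨α, hα⟩
  have hA := drawsUntil_full_pos hk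
  set N := drawsUntil k (k + 1)
  have hκ (s : C) (s' : R → C) :
      ENNReal.ofReal (lam / (k + 1)) ≤ ∫⁻ x, step s x (s' x) ∂(mixture D) := by
    obtain ⟨a, ha⟩ := h.miss s
    rw [lintegral_mixture, div_eq_inv_mul, ENNReal.ofReal_mul (by positivity),
      ENNReal.ofReal_inv_of_pos (by positivity),
      show ((k : ℝ) + 1) = ((k + 1 : ℕ) : ℝ) by push_cast; rfl, ENNReal.ofReal_natCast]
    gcongr
    refine le_trans ?_ (Finset.single_le_sum (fun _ _ => zero_le) (Finset.mem_univ a))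
    calc ENNReal.ofReal lam = ∫⁻ _, ENNReal.ofReal lam ∂(D a) := by
          rw [lintegral_const, measure_univ, mul_one]
      _ ≤ _ := lintegral_mono_ae ((hD a).mono fun x hx => ha x hx _)
  have hopt (T : ℕ) : ∫⁻ r, optCost step s₀ r ∂(Measure.pi fun _ : Fin T => mixture D) ≤
      ENNReal.ofReal (B + T * (Δ / N + δ)) := by
    refine (lintegral_mono fun r => h.optCost_le s₀ (S := {0}) r).trans ?_
    rw [lintegral_add_left measurable_const, lintegral_const, measure_univ, mul_one]
    have hne : ({0} : Finset (Fin (k + 1))) ≠ Finset.univ := by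
      intro he
      have := congrArg Finset.card he
      simp at this
      omega
    refine (add_le_add le_rfl
      (h.lintegral_guessCost_le hδ hΔ hk hD T (Finset.singleton_nonempty 0) hne)).trans_eq ?_
    rw [Finset.card_singleton, drawsUntil_one, ← ENNReal.ofReal_add hB (by positivity)]
    congr 1
    ring
  -- `max ρ 0` appears because `ENNReal.ofReal` truncates negative `ρ`.
  have hbound (T : ℕ) : T * (lam / (k + 1)) ≤ max ρ 0 * (B + T * (Δ / N + δ)) + α := by
    have h1 := (mul_le_lintegral_cost hstep (mixture D) hκ A T).trans ((hα T).trans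
      (add_le_add (mul_le_mul_right (hopt T) _) le_rfl))
    rw [← ENNReal.ofReal_natCast, ← ENNReal.ofReal_mul (by positivity),
      ← max_eq_left_iff.2 (zero_le (a := ENNReal.ofReal ρ)), ← ENNReal.ofReal_zero,
      ← ENNReal.ofReal_max, ← ENNReal.ofReal_mul (le_max_right _ _),
      ← ENNReal.ofReal_coe_nnreal, ← ENNReal.ofReal_add (by positivity) (by positivity),
      ENNReal.ofReal_le_ofReal_iff (by positivity)] at h1
    exact h1
  have hgap : 0 < lam / (k + 1) - max ρ 0 * (Δ / N + δ) := by
    rw [sub_pos, lt_div_iff₀ (by positivity)]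
    rcases le_total ρ 0 with h0 | h0
    · rw [max_eq_right h0]
      simpa using hlam
    · rw [max_eq_left h0]
      linarith
  obtain ⟨T, hT⟩ := exists_nat_gt ((max ρ 0 * B + α) / (lam / (k + 1) - max ρ 0 * (Δ / N + δ)))
  rw [div_lt_iff₀ hgap] at hT
  linarith [hbound T]

end IsCouponSystem

end Coupons

end OnlineLB

namespace OnlineLB

/-! ### The three problems as coupon systems -/

section CouponSystems

variable {M : Type*} [PseudoMetricSpace M] {k : ℕ} {c : Fin (k + 1) → M} {η ϱ lam : ℝ}

lemma IsCouponSystem.comp {C R R' : Type*} {step : C → R → C → ℝ≥0∞}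
    {Good : Fin (k + 1) → C → Prop} {E : Fin (k + 1) → Set R} {δ Δ B lam : ℝ}
    (h : IsCouponSystem step Good E δ Δ B lam) (f : R' → R) :
    IsCouponSystem (fun s r s' => step s (f r) s') Good (fun a => f ⁻¹' E a) δ Δ B lam where
  exists_good := h.exists_good
  stay a b s hab hs x hx := h.stay a b s hab hs (f x) hx
  move a b s hab hs x hx := h.move a b s hab hs (f x) hx
  start s₀ s x s' := h.start s₀ s (f x) s'
  miss s := (h.miss s).imp fun _ ha x hx s' => ha (f x) hx s'

lemma eq_of_near (hsep : ∀ a b, a ≠ b → 2 * lam + 2 * η ≤ dist (c a) (c b)) {s : M}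
    {a b : Fin (k + 1)} (ha : ∃ x ∈ Metric.closedBall (c a) η, dist s x < lam)
    (hb : ∃ x ∈ Metric.closedBall (c b) η, dist s x < lam) : a = b := by
  by_contra hab
  obtain ⟨x, hx, hsx⟩ := ha
  obtain ⟨y, hy, hsy⟩ := hb
  rw [Metric.mem_closedBall] at hx hy
  have h1 := dist_triangle4 (c a) x s (c b)
  have h2 := dist_triangle s y (c b)
  rw [dist_comm] at hx
  rw [dist_comm s x] at hsx
  linarith [hsep a b hab]

lemma exists_only_near (hsep : ∀ a b, a ≠ b → 2 * lam + 2 * η ≤ dist (c a) (c b)) (s : M) :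
    ∃ a : Fin (k + 1), ∀ b, (∃ x ∈ Metric.closedBall (c b) η, dist s x < lam) → b = a := by
  by_cases h : ∃ a : Fin (k + 1), ∃ x ∈ Metric.closedBall (c a) η, dist s x < lam
  · obtain ⟨a, ha⟩ := h
    exact ⟨a, fun b hb => eq_of_near hsep hb ha⟩
  · exact ⟨0, fun b hb => (h ⟨b, hb⟩).elim⟩

lemma edist_add_edist_le {D : ℝ} {x y z : M} (h : dist x y + dist y z ≤ D) :
    edist x y + edist y z ≤ ENNReal.ofReal D := by
  rw [edist_dist, edist_dist, ← ENNReal.ofReal_add dist_nonneg dist_nonneg]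
  exact ENNReal.ofReal_le_ofReal h

lemma sum_edist_le (hdiam : ∀ x y : M, dist x y ≤ 2 * ϱ) (s s' : Fin k → M) :
    ∑ j, edist (s j) (s' j) ≤ ENNReal.ofReal (k * (2 * ϱ)) := by
  calc ∑ j, edist (s j) (s' j) ≤ ∑ _j : Fin k, ENNReal.ofReal (2 * ϱ) := by
        gcongr with j
        rw [edist_dist]
        exact ENNReal.ofReal_le_ofReal (hdiam _ _)
    _ = _ := by
        rw [Finset.sum_const, Finset.card_univ, Fintype.card_fin, nsmul_eq_mul,
          ENNReal.ofReal_mul (p := (k : ℝ)) (by positivity), ENNReal.ofReal_natCast]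

/-- All points but `c b` are occupied. -/
def OccupiesAllBut (c : Fin (k + 1) → M) (b : Fin (k + 1)) (s : Fin k → M) : Prop :=
  ∀ a, a ≠ b → ∃ i, s i = c a

/-- Rides are trivial (`p.2 = p.1`), so taxis act as servers. Being good for `b` means that the only
hole is at `c b`. The bound `4 * ϱ` covers two legs of at most one diameter each. -/
lemma isCouponSystem_taxiStep (hη : 0 ≤ η) (hlam : 0 < lam)
    (hdiam : ∀ x y : M, dist x y ≤ 2 * ϱ)
    (hsep : ∀ a b, a ≠ b → 2 * lam + 2 * η ≤ dist (c a) (c b)) :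
    IsCouponSystem (taxiStep (k := k)) (OccupiesAllBut c)
      (fun a => {p : M × M | p.1 ∈ Metric.closedBall (c a) η ∧ p.2 = p.1})
      (2 * η) (4 * ϱ) (k * (2 * ϱ)) lam where
  exists_good b := ⟨fun i => c (b.succAbove i), fun a hab => by
    obtain ⟨i, hi⟩ := Fin.exists_succAbove_eq hab
    exact ⟨i, congrArg c hi⟩⟩
  stay := by
    rintro a b s hab hs ⟨x, y⟩ ⟨hx, rfl : y = x⟩
    obtain ⟨i, hi⟩ := hs a hab
    refine (iInf_le _ i).trans ?_
    simp only [edist_self, Finset.sum_const_zero, add_zero, hi]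
    have : dist y (c a) ≤ η := hx
    refine edist_add_edist_le ?_
    rw [dist_comm (c a)]
    linarith
  move := by
    rintro a b s hab hs ⟨x, y⟩ ⟨hx, rfl : y = x⟩
    obtain ⟨i, hi⟩ := hs b hab.symm
    -- The taxi at `c b` moves to `c a`, which shifts the hole from `a` to `b`.
    refine ⟨Function.update s i (c a), fun d hd => ?_, ?_⟩
    · by_cases hda : d = a
      · exact ⟨i, by simp [hda]⟩
      · obtain ⟨j, hj⟩ := hs d hda
        have hji : j ≠ i := by
          rintro rfl
          have h1 := hsep d b hd
          rw [← hj, ← hi, dist_self] at h1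
          linarith
        exact ⟨j, by rw [Function.update_of_ne hji, hj]⟩
    · refine (iInf_le _ i).trans ?_
      have h0 : ∑ j ∈ Finset.univ.erase i, edist (s j) (Function.update s i (c a) j) = 0 :=
        Finset.sum_eq_zero fun j hj => by
          rw [Function.update_of_ne (Finset.ne_of_mem_erase hj), edist_self]
      rw [h0, add_zero]
      refine edist_add_edist_le ?_
      linarith [hdiam (s i) y, hdiam y (Function.update s i (c a) i)]
  start s₀ s x s' := by
    unfold taxiStep
    rw [ENNReal.add_iInf]
    refine iInf_mono fun i => ?_
    calc edist (s₀ i) x.1 + edist x.2 (s' i) + ∑ j ∈ Finset.univ.erase i, edist (s₀ j) (s' j)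
        ≤ (edist (s₀ i) (s i) + edist (s i) x.1) + edist x.2 (s' i)
          + ∑ j ∈ Finset.univ.erase i, (edist (s₀ j) (s j) + edist (s j) (s' j)) := by
          gcongr <;> exact edist_triangle _ _ _
      _ = ∑ j, edist (s₀ j) (s j) + (edist (s i) x.1 + edist x.2 (s' i)
          + ∑ j ∈ Finset.univ.erase i, edist (s j) (s' j)) := by
          rw [Finset.sum_add_distrib, ← Finset.add_sum_erase _ _ (Finset.mem_univ i)]
          ring
      _ ≤ _ := by
          gcongr
          exact sum_edist_le hdiam s₀ s
  miss s := by
    -- Each taxi is near at most one blurred point, so `k` taxis leave one of the `k + 1` labels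
    -- uncovered.
    choose f hf using fun i => exists_only_near hsep (s i)
    obtain ⟨a, ha⟩ : ∃ a, ∀ i, f i ≠ a := by
      by_contra! hall
      have := Fintype.card_le_of_surjective f hall
      simp at this
    refine ⟨a, ?_⟩
    rintro ⟨x, y⟩ ⟨hx, -⟩ s'
    refine le_iInf fun i => ?_
    refine le_trans ?_ (le_trans le_self_add le_self_add)
    rw [edist_dist]
    refine ENNReal.ofReal_le_ofReal (le_of_not_gt fun hlt => ha i ?_)
    exact (hf i a ⟨x, hx, hlt⟩).symm

lemma isCouponSystem_serverStep (hη : 0 ≤ η) (hlam : 0 < lam)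
    (hdiam : ∀ x y : M, dist x y ≤ 2 * ϱ)
    (hsep : ∀ a b, a ≠ b → 2 * lam + 2 * η ≤ dist (c a) (c b)) :
    IsCouponSystem (serverStep (k := k)) (OccupiesAllBut c)
      (fun a => (fun x => (x, x)) ⁻¹' {p : M × M | p.1 ∈ Metric.closedBall (c a) η ∧ p.2 = p.1})
      (2 * η) (4 * ϱ) (k * (2 * ϱ)) lam :=
  (isCouponSystem_taxiStep hη hlam hdiam hsep).comp fun x => (x, x)

/-- The label `a` is the point omitted from the request: a server at `c b` is disturbed only by
label `b`. -/
lemma isCouponSystem_chasingStep (hdiam : ∀ x y : M, dist x y ≤ 2 * ϱ)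
    (hsep : ∀ a b, a ≠ b → 2 * lam + 2 * η ≤ dist (c a) (c b)) :
    IsCouponSystem (chasingStep (k := k)) (fun b s => s = c b)
      (fun a => {r : Fin k → M | ∀ i, r i ∈ Metric.closedBall (c (a.succAbove i)) η})
      (2 * η) (4 * ϱ) (2 * ϱ) lam where
  exists_good b := ⟨c b, rfl⟩
  stay := by
    rintro a b _ hab rfl x hx
    obtain ⟨i, rfl⟩ := Fin.exists_succAbove_eq hab.symm
    refine (iInf_le _ i).trans (edist_add_edist_le ?_)
    have : dist (x i) (c (a.succAbove i)) ≤ η := hx i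
    rw [dist_comm (c _)]
    linarith
  move := by
    rintro a b _ hab rfl x -
    obtain ⟨i, hi⟩ := Fin.exists_succAbove_eq hab.symm
    refine ⟨c b, rfl, (iInf_le _ i).trans (edist_add_edist_le ?_)⟩
    linarith [hdiam (c a) (x i), hdiam (x i) (c b)]
  start s₀ s x s' := by
    unfold chasingStep
    rw [ENNReal.add_iInf]
    refine iInf_mono fun i => ?_
    rw [← add_assoc]
    gcongr
    refine (edist_triangle _ s _).trans ?_
    gcongr
    rw [edist_dist]
    exact ENNReal.ofReal_le_ofReal (hdiam _ _)
  miss s := by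
    obtain ⟨a, ha⟩ := exists_only_near hsep s
    refine ⟨a, fun x hx s' => le_iInf fun i => le_trans ?_ le_self_add⟩
    rw [edist_dist]
    refine ENNReal.ofReal_le_ofReal (le_of_not_gt fun hlt => Fin.succAbove_ne a i ?_)
    exact ha _ ⟨x i, hx i, hlt⟩

end CouponSystems

/-! ### Measurability of the step costs -/

section Measurability

variable {M : Type*} [PseudoEMetricSpace M] [MeasurableSpace M] [OpensMeasurableSpace M]
  [SecondCountableTopology M] {k : ℕ}

lemma measurable_taxiStep : Measurable fun p : (Fin k → M) × (M × M) × (Fin k → M) =>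
    taxiStep p.1 p.2.1 p.2.2 := by
  unfold taxiStep
  fun_prop

lemma measurable_serverStep : Measurable fun p : (Fin k → M) × M × (Fin k → M) =>
    serverStep p.1 p.2.1 p.2.2 := by
  unfold serverStep
  fun_prop

lemma measurable_chasingStep : Measurable fun p : M × (Fin k → M) × M =>
    chasingStep p.1 p.2.1 p.2.2 := by
  unfold chasingStep
  fun_prop

end Measurability

/-! ### Smooth requests around separated points -/

section Requests

variable {k m : ℕ} {z : Fin m → ℝ} {ϱ ε σ : ℝ}

lemma isSmooth_map_mixture {R : Type*} [MeasurableSpace R] {D : Fin (k + 1) → Measure R}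
    {f : R → Ball z ϱ} (hf : Measurable f) (h : ∀ a, IsSmooth σ ((D a).map f)) :
    IsSmooth σ ((mixture D).map f) := by
  intro S hS
  rw [Measure.map_apply hf hS, mixture_apply]
  refine inv_mul_sum_le fun a => ?_
  rw [← Measure.map_apply hf hS]
  exact h a S hS

/-- The bound on `dist x.1 z` keeps the small ball inside the large one, so no mass is cut off at
the boundary. -/
lemma uniformBall_closedBall (hε : 0 < ε) (hϱ : 0 < ϱ) (x : Ball z ϱ)
    (hx : dist x.1 z ≤ (1 - ε) * ϱ) :
    uniformBall z ϱ (Metric.closedBall x (ε * ϱ)) = ENNReal.ofReal (ε ^ m) := by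
  have hsub : Metric.closedBall x.1 (ε * ϱ) ⊆ Metric.closedBall z ϱ :=
    Metric.closedBall_subset_closedBall' (by linarith)
  have himg : Subtype.val '' Metric.closedBall x (ε * ϱ) = Metric.closedBall x.1 (ε * ϱ) := by
    ext y
    constructor
    · rintro ⟨y, hy, rfl⟩
      exact hy
    · exact fun hy => ⟨⟨y, hsub hy⟩, hy, rfl⟩
  rw [uniformBall, (MeasurableEmbedding.subtype_coe
    Metric.isClosed_closedBall.measurableSet).comap_apply, himg,
    ProbabilityTheory.cond_apply Metric.isClosed_closedBall.measurableSet,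
    Set.inter_eq_self_of_subset_right hsub, Real.volume_pi_closedBall _ hϱ.le,
    Real.volume_pi_closedBall _ (by positivity), Fintype.card_fin,
    ← ENNReal.ofReal_inv_of_pos (by positivity), ← ENNReal.ofReal_mul (by positivity)]
  congr 1
  rw [show 2 * (ε * ϱ) = ε * (2 * ϱ) by ring, mul_pow ε, mul_comm, mul_assoc,
    mul_inv_cancel₀ (by positivity), mul_one]

/-- The uniform distribution over the small ball around `x`. -/
noncomputable def smallBall (ε : ℝ) (x : Ball z ϱ) : Measure (Ball z ϱ) :=
  ProbabilityTheory.cond (uniformBall z ϱ) (Metric.closedBall x (ε * ϱ))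

lemma isProbabilityMeasure_smallBall (hε : 0 < ε) (hϱ : 0 < ϱ) (x : Ball z ϱ)
    (hx : dist x.1 z ≤ (1 - ε) * ϱ) : IsProbabilityMeasure (smallBall ε x) := by
  have h := uniformBall_closedBall hε hϱ x hx
  refine ProbabilityTheory.cond_isProbabilityMeasure_of_finite ?_ ?_
  · rw [h]
    simpa using pow_pos hε m
  · rw [h]
    exact ENNReal.ofReal_ne_top

lemma isSmooth_smallBall (hε : 0 < ε) (hϱ : 0 < ϱ) (x : Ball z ϱ)
    (hx : dist x.1 z ≤ (1 - ε) * ϱ) : IsSmooth (ε ^ m) (smallBall ε x) := by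
  intro S hS
  rw [smallBall, ProbabilityTheory.cond_apply Metric.isClosed_closedBall.measurableSet,
    uniformBall_closedBall hε hϱ x hx, one_div, ENNReal.ofReal_inv_of_pos (by positivity)]
  gcongr
  exact Set.inter_subset_right

lemma ae_smallBall (x : Ball z ϱ) :
    ∀ᵐ y ∂(smallBall ε x), y ∈ Metric.closedBall x (ε * ϱ) :=
  ProbabilityTheory.ae_cond_mem Metric.isClosed_closedBall.measurableSet

/-- The points are corners of the cube of radius `(1 - ε) * ϱ`: distinct sign vectors differ in a
coordinate, and in the maximum norm one coordinate gives the full distance. -/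
lemma exists_separated (hm : k + 1 ≤ 2 ^ m) (hε : 0 ≤ ε) (hε' : ε ≤ 1) (hϱ : 0 < ϱ) :
    ∃ c : Fin (k + 1) → Ball z ϱ, (∀ a, dist (c a).1 z ≤ (1 - ε) * ϱ) ∧
      ∀ a b, a ≠ b → 2 * (1 - ε) * ϱ ≤ dist (c a) (c b) := by
  obtain ⟨e⟩ : Nonempty (Fin (k + 1) ↪ (Fin m → Bool)) :=
    Function.Embedding.nonempty_of_card_le (by simpa using hm)
  have hr : 0 ≤ (1 - ε) * ϱ := mul_nonneg (by linarith) hϱ.le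
  set p : Fin (k + 1) → Fin m → ℝ :=
    fun a i => z i + if e a i then (1 - ε) * ϱ else -((1 - ε) * ϱ) with hp
  have hpz (a) : dist (p a) z ≤ (1 - ε) * ϱ := by
    refine (dist_pi_le_iff hr).2 fun i => ?_
    rw [Real.dist_eq]
    simp only [hp, add_sub_cancel_left]
    split_ifs
    · rw [abs_of_nonneg hr]
    · rw [abs_neg, abs_of_nonneg hr]
  refine ⟨fun a => ⟨p a, (hpz a).trans ?_⟩, hpz, fun a b hab => ?_⟩
  · nlinarith
  · obtain ⟨i, hi⟩ := Function.ne_iff.1 (e.injective.ne hab)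
    change _ ≤ dist (p a) (p b)
    refine le_trans ?_ (dist_le_pi_dist (p a) (p b) i)
    rw [Real.dist_eq]
    simp only [hp, add_sub_add_left_eq_sub]
    cases ha : e a i <;> cases hb : e b i <;> simp_all
    · rw [abs_sub_comm, le_abs]
      left
      linarith
    · rw [le_abs]
      left
      linarith

lemma dist_ball_le (x y : Ball z ϱ) : dist x y ≤ 2 * ϱ := by
  have h1 : dist x.1 z ≤ ϱ := x.2
  have h2 : dist y.1 z ≤ ϱ := y.2
  have h3 := dist_triangle_right x.1 y.1 z
  change dist x.1 y.1 ≤ _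
  linarith

theorem exists_smooth_noCompetitiveIID (hk : 0 < k) (hm : k + 1 ≤ 2 ^ m) (hε : 0 < ε)
    (hε' : ε ≤ 1 / 4) (hϱ : 0 < ϱ) {ρ : ℝ}
    (hρ : ρ * (4 / harmonic k + 2 * ε * (k + 1)) < 1 / 2) :
    (∃ D : Measure (Ball z ϱ), IsProbabilityMeasure D ∧ IsSmooth (ε ^ m) D ∧
      NoCompetitiveIID.{u} (serverStep (k := k)) D ρ) ∧
    (∃ D : Measure (Ball z ϱ × Ball z ϱ), IsProbabilityMeasure D ∧
      IsSmooth (ε ^ m) (D.map Prod.fst) ∧ IsSmooth (ε ^ m) (D.map Prod.snd) ∧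
      NoCompetitiveIID.{u} (taxiStep (k := k)) D ρ) ∧
    (∃ D : Measure (Fin k → Ball z ϱ), IsProbabilityMeasure D ∧
      (∀ i, IsSmooth (ε ^ m) (D.map fun r => r i)) ∧
      NoCompetitiveIID.{u} (chasingStep (k := k)) D ρ) := by
  obtain ⟨c, hcz, hcc⟩ := exists_separated (z := z) hm hε.le (by linarith) hϱ
  have hη : 0 ≤ ε * ϱ := by positivity
  have hlam : 0 < ϱ / 2 := by positivity
  -- With `lam = ϱ / 2` and `η = ε * ϱ` this asks for `1 + 2 * ε ≤ 2 * (1 - ε)`, that is, `ε ≤ 1 /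
  -- 4`.
  have hsep (a b) (hab : a ≠ b) : 2 * (ϱ / 2) + 2 * (ε * ϱ) ≤ dist (c a) (c b) :=
    le_trans (by nlinarith) (hcc a b hab)
  have hprob (a) := isProbabilityMeasure_smallBall hε hϱ (c a) (hcz a)
  have hsmooth (a) := isSmooth_smallBall hε hϱ (c a) (hcz a)
  have hH : (0 : ℝ) < harmonic k := by exact_mod_cast harmonic_pos hk.ne'
  have hrate : (k + 1) * ρ * (4 * ϱ / drawsUntil k (k + 1) + 2 * (ε * ϱ)) < ϱ / 2 := by
    have : (k + 1) * ρ * (4 * ϱ / drawsUntil k (k + 1) + 2 * (ε * ϱ)) =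
        ρ * (4 / harmonic k + 2 * ε * (k + 1)) * ϱ := by
      rw [drawsUntil_full]
      field_simp
    rw [this]
    nlinarith
  have hdiag : Measurable fun x : Ball z ϱ => (x, x) := by fun_prop
  have hprob' (a) : IsProbabilityMeasure ((smallBall ε (c a)).map fun x => (x, x)) :=
    Measure.isProbabilityMeasure_map hdiag.aemeasurable
  refine ⟨⟨mixture fun a => smallBall ε (c a), inferInstance, ?_, ?_⟩,
    ⟨mixture fun a => (smallBall ε (c a)).map fun x => (x, x), ?_, ?_, ?_, ?_⟩,
    ⟨mixture fun a => Measure.pi fun i => smallBall ε (c (a.succAbove i)), inferInstance, ?_, ?_⟩⟩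
  · rw [← Measure.map_id (μ := mixture _)]
    refine isSmooth_map_mixture measurable_id fun a => ?_
    rw [Measure.map_id]
    exact hsmooth a
  · refine (isCouponSystem_serverStep hη hlam dist_ball_le hsep).noCompetitiveIID
      measurable_serverStep (by positivity) (by positivity) (by positivity) hk (fun a => ?_) hrate
      hlam
    filter_upwards [ae_smallBall (c a)] with x hx using ⟨hx, rfl⟩
  · infer_instance
  · refine isSmooth_map_mixture measurable_fst fun a => ?_
    rw [Measure.map_map measurable_fst hdiag]
    exact (Measure.map_id (μ := smallBall ε (c a))).symm ▸ hsmooth a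
  · refine isSmooth_map_mixture measurable_snd fun a => ?_
    rw [Measure.map_map measurable_snd hdiag]
    exact (Measure.map_id (μ := smallBall ε (c a))).symm ▸ hsmooth a
  · refine (isCouponSystem_taxiStep hη hlam dist_ball_le hsep).noCompetitiveIID
      measurable_taxiStep (by positivity) (by positivity) (by positivity) hk (fun a => ?_) hrate
      hlam
    have hE : MeasurableSet {p : Ball z ϱ × Ball z ϱ |
        p.1 ∈ Metric.closedBall (c a) (ε * ϱ) ∧ p.2 = p.1} :=
      (measurable_fst Metric.isClosed_closedBall.measurableSet).inter
        (measurableSet_eq_fun measurable_snd measurable_fst)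
    refine (ae_map_iff hdiag.aemeasurable hE).2 ?_
    filter_upwards [ae_smallBall (c a)] with x hx using ⟨hx, rfl⟩
  · intro i
    refine isSmooth_map_mixture (measurable_pi_apply i) fun a => ?_
    exact (measurePreserving_eval (fun i => smallBall ε (c (a.succAbove i))) i).map_eq.symm ▸
      hsmooth _
  · refine (isCouponSystem_chasingStep dist_ball_le hsep).noCompetitiveIID
      measurable_chasingStep (by positivity) (by positivity) (by positivity) hk (fun a => ?_) hrate
      hlam
    refine ae_all_iff.2 fun i => ?_
    exact (measurePreserving_eval (fun i => smallBall ε (c (a.succAbove i)))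
      i).quasiMeasurePreserving.ae (ae_smallBall (c (a.succAbove i)))

end Requests

end OnlineLB

namespace OnlineLB

/-! ### Choice of parameters and asymptotics -/

open Filter Topology in
lemma exists_forall_mul_rpow_lt {c : ℝ} (hc : c < 1 / 2) (C : ℝ) :
    ∃ L₀ : ℝ, 1 ≤ L₀ ∧ ∀ L, L₀ ≤ L → ∀ y, L ≤ y → y ≤ 13 * L ^ 2 → 12 * (C * y ^ c) < L := by
  -- For negative `c` the map `y ↦ y ^ c` is decreasing; as `y ≥ 1`, the exponent can be raised to
  -- `0`.
  set d := max c 0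
  have hd : d < 1 / 2 := max_lt hc (by norm_num)
  have hd0 : 0 ≤ d := le_max_right _ _
  have ht : Tendsto (fun L : ℝ => L ^ (1 - 2 * d)) atTop atTop :=
    tendsto_rpow_atTop (by linarith)
  obtain ⟨L₁, hL₁⟩ := eventually_atTop.1 (ht.eventually_gt_atTop (12 * (|C| * 13 ^ d)))
  refine ⟨max L₁ 1, le_max_right _ _, fun L hL y hLy hy => ?_⟩
  have hL1 : 1 ≤ L := (le_max_right _ _).trans hL
  have hL0 : 0 < L := by linarith
  have hy0 : 0 < y := by linarith
  have h1 : y ^ c ≤ 13 ^ d * L ^ (2 * d) := by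
    calc y ^ c ≤ y ^ d := Real.rpow_le_rpow_of_exponent_le (by linarith) (le_max_left _ _)
      _ ≤ (13 * L ^ 2) ^ d := Real.rpow_le_rpow hy0.le hy hd0
      _ = _ := by
        rw [Real.mul_rpow (by norm_num) (by positivity), ← Real.rpow_natCast L 2,
          ← Real.rpow_mul hL0.le]
        norm_num
  calc 12 * (C * y ^ c) ≤ 12 * (|C| * (13 ^ d * L ^ (2 * d))) := by
        have h0 : 0 ≤ y ^ c := by positivity
        gcongr
        exact le_abs_self C
    _ = 12 * (|C| * 13 ^ d) * L ^ (2 * d) := by ring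
    _ < L ^ (1 - 2 * d) * L ^ (2 * d) :=
        mul_lt_mul_of_pos_right (hL₁ L ((le_max_left _ _).trans hL)) (by positivity)
    _ = L := by
        rw [← Real.rpow_add hL0, sub_add_cancel, Real.rpow_one]

/-- With `ε = 1 / (k + 1) ^ 2` the blur contributes only `2 / (k + 1) ≤ 2 / log k`, so the rate is
at most `6 / log k`; this is the source of the `12`. -/
lemma rate_lt_half {k : ℕ} (hk : 0 < k) {ρ : ℝ} (hρ : 12 * ρ < Real.log k) (hlog : 1 ≤ Real.log k) :
    ρ * (4 / harmonic k + 2 * (1 / ((k : ℝ) + 1) ^ 2) * (k + 1)) < 1 / 2 := by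
  have hk0 : (0 : ℝ) < k := by exact_mod_cast hk
  have hL : 0 < Real.log k := by linarith
  have hH : Real.log k ≤ harmonic k :=
    (Real.log_le_log hk0 (by push_cast; linarith)).trans (log_add_one_le_harmonic k)
  have hk1 : Real.log k ≤ k + 1 := by linarith [Real.log_le_sub_one_of_pos hk0]
  have h1 : 2 * (1 / ((k : ℝ) + 1) ^ 2) * (k + 1) = 2 / (k + 1) := by field_simp
  have hH0 : (0 : ℝ) < harmonic k := hL.trans_le hH
  rw [h1]
  rcases le_or_gt ρ 0 with h0 | h0
  · have : 0 ≤ 4 / (harmonic k : ℝ) + 2 / (k + 1) := by positivity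
    nlinarith
  · calc ρ * (4 / harmonic k + 2 / (k + 1)) ≤ ρ * (4 / Real.log k + 2 / Real.log k) := by gcongr
      _ = 6 * ρ / Real.log k := by ring
      _ < 1 / 2 := by
        rw [div_lt_iff₀ hL]
        linarith

lemma natLog_two_add_one_le {k : ℕ} (hk : 0 < k) (hlog : 1 ≤ Real.log k) :
    ((Nat.log 2 k + 1 : ℕ) : ℝ) ≤ 3 * Real.log k := by
  have h2 := Real.log_two_gt_d9
  have h1 : (Nat.log 2 k : ℝ) * Real.log 2 ≤ Real.log k := by
    rw [← Real.log_pow]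
    apply Real.log_le_log (by positivity)
    exact_mod_cast Nat.pow_log_le_self 2 hk.ne'
  have h3 : (0 : ℝ) ≤ Nat.log 2 k := by positivity
  push_cast
  nlinarith

/-- `log (k / σ) = log k + 2 * m * log (k + 1)`, where `m ≤ 3 * log k` and `log (k + 1) ≤ 2 * log
k`; hence `13 = 1 + 3 * 2 * 2`. -/
lemma log_div_pow_bounds {k m : ℕ} (hk : 0 < k) (hlog : 1 ≤ Real.log k)
    (hm : (m : ℝ) ≤ 3 * Real.log k) :
    Real.log k ≤ Real.log (k / (1 / ((k : ℝ) + 1) ^ 2) ^ m) ∧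
      Real.log (k / (1 / ((k : ℝ) + 1) ^ 2) ^ m) ≤ 13 * Real.log k ^ 2 := by
  have hk0 : (0 : ℝ) < k := by exact_mod_cast hk
  have heq : Real.log (k / (1 / ((k : ℝ) + 1) ^ 2) ^ m) =
      Real.log k + m * (2 * Real.log (k + 1)) := by
    rw [Real.log_div hk0.ne' (by positivity), Real.log_pow, one_div, Real.log_inv, Real.log_pow]
    push_cast
    ring
  have h1 : 0 ≤ Real.log ((k : ℝ) + 1) := Real.log_nonneg (by linarith)
  have h2 : Real.log ((k : ℝ) + 1) ≤ 2 * Real.log k := by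
    have hk2 : (k : ℝ) + 1 ≤ k ^ 2 := by
      have : 2 ≤ k := by
        by_contra! hlt
        interval_cases k
        simp at hlog
        linarith
      have : (2 : ℝ) ≤ k := by exact_mod_cast this
      nlinarith
    calc Real.log ((k : ℝ) + 1) ≤ Real.log (k ^ 2) := Real.log_le_log (by linarith) hk2
      _ = 2 * Real.log k := by rw [Real.log_pow]; norm_num
  have hm0 : (0 : ℝ) ≤ m := by positivity
  rw [heq]
  refine ⟨by nlinarith [mul_nonneg hm0 h1], ?_⟩
  calc Real.log k + m * (2 * Real.log (k + 1))
      ≤ Real.log k * Real.log k + 3 * Real.log k * (2 * (2 * Real.log k)) := by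
        gcongr
        exact le_mul_of_one_le_left (by linarith) hlog
    _ = 13 * Real.log k ^ 2 := by ring

end OnlineLB

theorem theorem4 :
    ∃ K : ℝ, ∀ c : ℝ, c < 1 / 2 → ∀ C : ℝ, ∃ k₀ : ℕ, ∀ k : ℕ, k₀ ≤ k →
      ∃ (m : ℕ) (σ : ℝ), (m : ℝ) ≤ K * Real.log k ∧ 0 < σ ∧ σ ≤ 1 ∧
        ∀ (z : Fin m → ℝ) (ϱ : ℝ), 0 < ϱ →
          -- the k-server problem
          (∃ D : Measure (OnlineLB.Ball z ϱ), IsProbabilityMeasure D ∧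
            OnlineLB.IsSmooth σ D ∧
            OnlineLB.NoCompetitiveIID.{u} (OnlineLB.serverStep (k := k)) D
              (C * Real.log (k / σ) ^ c)) ∧
          -- the k-taxi problem
          (∃ D : Measure (OnlineLB.Ball z ϱ × OnlineLB.Ball z ϱ), IsProbabilityMeasure D ∧
            OnlineLB.IsSmooth σ (D.map Prod.fst) ∧ OnlineLB.IsSmooth σ (D.map Prod.snd) ∧
            OnlineLB.NoCompetitiveIID.{u} (OnlineLB.taxiStep (k := k)) D
              (C * Real.log (k / σ) ^ c)) ∧
          -- chasing sets of at most k points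
          (∃ D : Measure (Fin k → OnlineLB.Ball z ϱ), IsProbabilityMeasure D ∧
            (∀ i, OnlineLB.IsSmooth σ (D.map fun r => r i)) ∧
            OnlineLB.NoCompetitiveIID.{u} (OnlineLB.chasingStep (k := k)) D
              (C * Real.log (k / σ) ^ c)) := by

  refine ⟨3, fun c hc C => ?_⟩
  obtain ⟨L₀, hL₀, hlt⟩ := OnlineLB.exists_forall_mul_rpow_lt hc C
  have htend : Filter.Tendsto (fun k : ℕ => Real.log k) Filter.atTop Filter.atTop :=
    Real.tendsto_log_atTop.comp tendsto_natCast_atTop_atTop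
  obtain ⟨k₀, hk₀⟩ := Filter.eventually_atTop.1 (htend.eventually_ge_atTop L₀)
  refine ⟨max k₀ 1, fun k hk => ?_⟩
  have hkpos : 0 < k := (le_max_right _ _).trans hk
  have hL : L₀ ≤ Real.log k := hk₀ k ((le_max_left _ _).trans hk)
  have hlog : 1 ≤ Real.log k := hL₀.trans hL
  have hm := OnlineLB.natLog_two_add_one_le hkpos hlog
  have hk1 : (1 : ℝ) ≤ k := by exact_mod_cast hkpos
  have hε : (0 : ℝ) < 1 / ((k : ℝ) + 1) ^ 2 := by positivity
  have hε' : 1 / ((k : ℝ) + 1) ^ 2 ≤ 1 / 4 := by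
    apply one_div_le_one_div_of_le (by norm_num)
    nlinarith
  obtain ⟨h1, h2⟩ := OnlineLB.log_div_pow_bounds hkpos hlog hm
  refine ⟨Nat.log 2 k + 1, (1 / ((k : ℝ) + 1) ^ 2) ^ (Nat.log 2 k + 1), hm, by positivity,
    pow_le_one₀ hε.le (by linarith), fun z ϱ hϱ => ?_⟩
  exact OnlineLB.exists_smooth_noCompetitiveIID hkpos (Nat.lt_pow_succ_log_self one_lt_two k)
    hε hε' hϱ (OnlineLB.rate_lt_half hkpos (hlt _ hL _ h1 h2) hlog)
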